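/- Let $(\mathcal X,\mathsf d)$ be a separable metric space with Borel $\sigma$-algebra $\mathfrak B(\mathcal X)$, let $\mu$ be a Borel probability measure on $\mathcal X\times\{0,1\}$, and let $\varepsilon>0$. Put $w_i:=\mu(\mathcal X\times\{i\})$ and, for $i\in\{0,1\}$ with $w_i>0$, $\rho_i(A):=\mu(A\times\{i\})/w_i$ (terms with $w_i=0$ are read as $0$). With the open balls $B_\varepsilon(x)=\{\tilde x:\mathsf d(x,\tilde x)<\varepsilon\}$ define, for $A\in\mathfrak B(\mathcal X)$, $$\widetilde{\operatorname{Per}}_\varepsilon(A;\mu):=\frac{w_0}{\varepsilon}\int_{\mathcal X}\Big(\sup_{\tilde x\in B_\varepsilon(x)}1_A(\tilde x)-1_A(x)\Big)\,d\rho_0(x)+\frac{w_1}{\varepsilon}\int_{\mathcal X}\Big(1_A(x)-\inf_{\tilde x\in B_\varepsilon(x)}1_A(\tilde x)\Big)\,d\rho_1(x).$$ For a Borel measure $\nu$ on $\mathcal X$ and $A,B\in\mathfrak B(\mathcal X)$ write $A\sim_\nu B$ if $\nu(A\triangle B)=0$, write $A\preceq_\nu B$ if $1_A\le 1_B$ holds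 $\nu$-a.e., and set $$\operatorname{Per}^\nu_\varepsilon(A;\mu):=\inf\{\widetilde{\operatorname{Per}}_\varepsilon(B;\mu):B\in\mathfrak B(\mathcal X),\ A\sim_\nu B\}.$$ A set $A\in\mathfrak B(\mathcal X)$ is a solution of the perimeter-regularized problem $$\inf_{A\in\mathfrak B(\mathcal X)}\ \mathbb E_{(x,y)\sim\mu}\big[|1_A(x)-y|\big]+\varepsilon\operatorname{Per}^\nu_\varepsilon(A;\mu)\tag{P}$$ if it attains the infimum. A solution $A$ is called maximal (respectively minimal) if every solution $A'$ with $A\preceq_\nu A'$ (respectively $A'\preceq_\nu A$) satisfies $A\sim_\nu A'$. Proposition. Let $\nu$ be a finite Borel measure on $\mathcal X$. Then (P) has a maximal solution $A_{\max}$, and every maximal solution $A'$ satisfies $A'\sim_\nu A_{\max}$. Likewise, (P) has a minimal solution $A_{\min}$, and every minimal solution $A'$ satisfies $A'\sim_\nu A_{\min}$. -/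

import Mathlib

open MeasureTheory Set
open scoped symmDiff

noncomputable section

namespace AdvTraining

/-- The real-valued indicator function of a set `A`. -/
def ind {X : Type*} (A : Set X) : X → ℝ := A.indicator (fun _ => (1 : ℝ))

/-- The equivalence `A ∼_ν B`: the symmetric difference is a `ν`-null set. -/
def NuEquiv {X : Type*} [MeasurableSpace X] (ν : Measure X) (A B : Set X) : Prop :=
  ν (A ∆ B) = 0

/-- The order `A ⪯_ν B`: `1_A ≤ 1_B` holds `ν`-almost everywhere. -/
def NuLE {X : Type*} [MeasurableSpace X] (ν : Measure X) (A B : Set X) : Prop :=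
  ∀ᵐ x ∂ν, ind A x ≤ ind B x

/-- The class probability `w_i = μ (X × {i})`. -/
def classProb {X : Type*} [MeasurableSpace X] (μ : Measure (X × Fin 2)) (i : Fin 2) : ℝ :=
  (μ (univ ×ˢ {i})).toReal

/-- The conditional distribution `ρ_i (A) = μ (A × {i}) / w_i`. If `w_i = 0` this is the zero
measure; it is only ever used multiplied by `w_i`. -/
def condDist {X : Type*} [MeasurableSpace X] (μ : Measure (X × Fin 2)) (i : Fin 2) : Measure X :=
  (μ (univ ×ˢ {i}))⁻¹ • (μ.restrict (univ ×ˢ {i})).map Prod.fst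

/-- The unregularized risk `E_{(x,y) ∼ μ} |1_A(x) - y|`. -/
def risk {X : Type*} [MeasurableSpace X] (μ : Measure (X × Fin 2)) (A : Set X) : ℝ :=
  ∫ p, |ind A p.1 - ((p.2 : ℕ) : ℝ)| ∂μ

/-- The nonlocal pre-perimeter of `A` with parameter `ε`, with open balls. -/
def prePer {X : Type*} [MetricSpace X] [MeasurableSpace X]
    (ε : ℝ) (μ : Measure (X × Fin 2)) (A : Set X) : ℝ :=
  classProb μ 0 / ε *
      ∫ x, ((⨆ z : Metric.ball x ε, ind A (z : X)) - ind A x) ∂(condDist μ 0) +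
    classProb μ 1 / ε *
      ∫ x, (ind A x - ⨅ z : Metric.ball x ε, ind A (z : X)) ∂(condDist μ 1)

/-- The nonlocal perimeter with respect to `ν`: the infimum of the pre-perimeter over all Borel
sets that are `ν`-equivalent to `A`. -/
def per {X : Type*} [MetricSpace X] [MeasurableSpace X]
    (ν : Measure X) (ε : ℝ) (μ : Measure (X × Fin 2)) (A : Set X) : ℝ :=
  ⨅ B : {B : Set X // MeasurableSet B ∧ NuEquiv ν A B}, prePer ε μ (B : Set X)

/-- The objective of the perimeter-regularized problem. -/
def objective {X : Type*} [MetricSpace X] [MeasurableSpace X]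
    (ν : Measure X) (ε : ℝ) (μ : Measure (X × Fin 2)) (A : Set X) : ℝ :=
  risk μ A + ε * per ν ε μ A

/-- `A` is a solution of the perimeter-regularized problem: a Borel set that minimizes the
objective among all Borel sets. -/
def IsSolution {X : Type*} [MetricSpace X] [MeasurableSpace X]
    (ν : Measure X) (ε : ℝ) (μ : Measure (X × Fin 2)) (A : Set X) : Prop :=
  MeasurableSet A ∧ ∀ A' : Set X, MeasurableSet A' → objective ν ε μ A ≤ objective ν ε μ A'

/-- A maximal solution of the perimeter-regularized problem. -/
def IsMaximalSolution {X : Type*} [MetricSpace X] [MeasurableSpace X]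
    (ν : Measure X) (ε : ℝ) (μ : Measure (X × Fin 2)) (A : Set X) : Prop :=
  IsSolution ν ε μ A ∧ ∀ A' : Set X, IsSolution ν ε μ A' → NuLE ν A A' → NuEquiv ν A A'

/-- A minimal solution of the perimeter-regularized problem. -/
def IsMinimalSolution {X : Type*} [MetricSpace X] [MeasurableSpace X]
    (ν : Measure X) (ε : ℝ) (μ : Measure (X × Fin 2)) (A : Set X) : Prop :=
  IsSolution ν ε μ A ∧ ∀ A' : Set X, IsSolution ν ε μ A' → NuLE ν A' A → NuEquiv ν A A'

end AdvTraining

end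

namespace AdvTraining

open Filter Topology

variable {X : Type*} [MeasurableSpace X]

/-! The objective is submodular and lower semicontinuous along monotone sequences of sets, and these
two properties replace compactness. If `B n` is within `2⁻ⁿ` of the infimum, submodularity lets the
errors add up under unions, so tail unions are nearly optimal and the limsup set is a minimizer
(`exists_min`). This works in any family closed under countable unions and intersections.

That existence result is used three times: to minimize the objective; to attain the infimum defining
the perimeter within a `ν`-class, which makes the perimeter inherit both properties
(`SubmodularLSC.classInf`); and to maximize `ν` over the minimizers, which themselves form such a
family. A minimizer of greatest `ν`-measure contains all others up to null sets, hence is the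
maximal solution. Complementation gives the minimal one. -/

/-- A nonnegative set functional that is submodular on measurable sets and lower semicontinuous
along monotone sequences of measurable sets. -/
structure SubmodularLSC (Φ : Set X → ℝ) : Prop where
  nonneg : ∀ A, MeasurableSet A → 0 ≤ Φ A
  submod : ∀ A B, MeasurableSet A → MeasurableSet B → Φ (A ∪ B) + Φ (A ∩ B) ≤ Φ A + Φ B
  iUnion : ∀ B : ℕ → Set X, (∀ n, MeasurableSet (B n)) → Monotone B →
    ∀ c < Φ (⋃ n, B n), ∀ᶠ n in atTop, c < Φ (B n)
  iInter : ∀ B : ℕ → Set X, (∀ n, MeasurableSet (B n)) → Antitone B →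
    ∀ c < Φ (⋂ n, B n), ∀ᶠ n in atTop, c < Φ (B n)

/-! ### Stability and existence of minimizers -/

namespace SubmodularLSC

variable {Φ Ψ : Set X → ℝ}

theorem add (hΦ : SubmodularLSC Φ) (hΨ : SubmodularLSC Ψ) :
    SubmodularLSC (fun A => Φ A + Ψ A) where
  nonneg A hA := add_nonneg (hΦ.nonneg A hA) (hΨ.nonneg A hA)
  submod A B hA hB := by
    have := hΦ.submod A B hA hB
    have := hΨ.submod A B hA hB
    linarith
  iUnion B hB hm c hc := by
    set a := Φ (⋃ n, B n)
    set b := Ψ (⋃ n, B n)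
    filter_upwards [hΦ.iUnion B hB hm (a - (a + b - c) / 2) (by linarith),
      hΨ.iUnion B hB hm (b - (a + b - c) / 2) (by linarith)] with n h1 h2
    linarith
  iInter B hB hm c hc := by
    set a := Φ (⋂ n, B n)
    set b := Ψ (⋂ n, B n)
    filter_upwards [hΦ.iInter B hB hm (a - (a + b - c) / 2) (by linarith),
      hΨ.iInter B hB hm (b - (a + b - c) / 2) (by linarith)] with n h1 h2
    linarith

theorem const_mul (hΦ : SubmodularLSC Φ) {r : ℝ} (hr : 0 < r) :
    SubmodularLSC (fun A => r * Φ A) where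
  nonneg A hA := mul_nonneg hr.le (hΦ.nonneg A hA)
  submod A B hA hB := by
    have := mul_le_mul_of_nonneg_left (hΦ.submod A B hA hB) hr.le
    linarith
  iUnion B hB hm c hc := by
    filter_upwards [hΦ.iUnion B hB hm (c / r) ((div_lt_iff₀' hr).2 hc)] with n h
    exact (div_lt_iff₀' hr).1 h
  iInter B hB hm c hc := by
    filter_upwards [hΦ.iInter B hB hm (c / r) ((div_lt_iff₀' hr).2 hc)] with n h
    exact (div_lt_iff₀' hr).1 h

theorem compl (hΦ : SubmodularLSC Φ) : SubmodularLSC (fun A => Φ Aᶜ) where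
  nonneg A hA := hΦ.nonneg _ hA.compl
  submod A B hA hB := by
    have := hΦ.submod Aᶜ Bᶜ hA.compl hB.compl
    rw [compl_union, compl_inter]
    linarith
  iUnion B hB hm c hc := by
    rw [compl_iUnion] at hc
    exact hΦ.iInter (fun n => (B n)ᶜ) (fun n => (hB n).compl)
      (fun i j h => compl_subset_compl.2 (hm h)) c hc
  iInter B hB hm c hc := by
    rw [compl_iInter] at hc
    exact hΦ.iUnion (fun n => (B n)ᶜ) (fun n => (hB n).compl)
      (fun i j h => compl_subset_compl.2 (hm h)) c hc

theorem iUnion_le (hΦ : SubmodularLSC Φ) {B : ℕ → Set X} (hB : ∀ n, MeasurableSet (B n))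
    (hm : Monotone B) {c : ℝ} (h : ∀ n, Φ (B n) ≤ c) : Φ (⋃ n, B n) ≤ c := by
  by_contra! hc
  obtain ⟨n, hn⟩ := (hΦ.iUnion B hB hm c hc).exists
  exact (h n).not_gt hn

theorem iInter_le (hΦ : SubmodularLSC Φ) {B : ℕ → Set X} (hB : ∀ n, MeasurableSet (B n))
    (hm : Antitone B) {c : ℝ} (h : ∀ᶠ n in atTop, Φ (B n) ≤ c) : Φ (⋂ n, B n) ≤ c := by
  by_contra! hc
  obtain ⟨n, hn, hn'⟩ := ((hΦ.iInter B hB hm c hc).and h).exists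
  exact hn'.not_gt hn

/-- A submodular functional that is lower semicontinuous along monotone sequences attains its
minimum over every nonempty family closed under countable unions and intersections. -/
theorem exists_min (hΦ : SubmodularLSC Φ) (F : Set (Set X)) (hne : F.Nonempty)
    (hmeas : ∀ A ∈ F, MeasurableSet A)
    (hU : ∀ B : ℕ → Set X, (∀ n, B n ∈ F) → (⋃ n, B n) ∈ F)
    (hI : ∀ B : ℕ → Set X, (∀ n, B n ∈ F) → (⋂ n, B n) ∈ F) :
    ∃ C ∈ F, ∀ B ∈ F, Φ C ≤ Φ B := by
  have hinter : ∀ A ∈ F, ∀ B ∈ F, A ∩ B ∈ F := by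
    intro A hA B hB
    have := hI (fun n => if n = 0 then A else B) (fun n => by split_ifs <;> assumption)
    convert this using 1
    ext x
    simp only [mem_inter_iff, mem_iInter]
    refine ⟨fun h n => by split_ifs; exacts [h.1, h.2], fun h => ⟨?_, ?_⟩⟩
    · simpa using h 0
    · simpa using h 1
  have hunion : ∀ A ∈ F, ∀ B ∈ F, A ∪ B ∈ F := by
    intro A hA B hB
    have := hU (fun n => if n = 0 then A else B) (fun n => by split_ifs <;> assumption)
    convert this using 1
    ext x
    simp only [mem_union, mem_iUnion]
    refine ⟨?_, ?_⟩
    · rintro (h | h)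
      exacts [⟨0, by simpa using h⟩, ⟨1, by simpa using h⟩]
    · rintro ⟨n, h⟩
      split_ifs at h
      exacts [Or.inl h, Or.inr h]
  set I := sInf (Φ '' F)
  have hbdd : BddBelow (Φ '' F) := ⟨0, by rintro _ ⟨A, hA, rfl⟩; exact hΦ.nonneg A (hmeas A hA)⟩
  have hIle : ∀ A ∈ F, I ≤ Φ A := fun A hA => csInf_le hbdd ⟨A, hA, rfl⟩
  have hseq : ∀ n : ℕ, ∃ B ∈ F, Φ B < I + (1 / 2) ^ n := by
    intro n
    obtain ⟨_, ⟨B, hB, rfl⟩, h⟩ := exists_lt_of_csInf_lt (hne.image Φ)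
      (show sInf (Φ '' F) < I + (1 / 2) ^ n from lt_add_of_pos_right _ (by positivity))
    exact ⟨B, hB, h⟩
  choose B hBF hB using hseq
  -- The intersection lies in `F`, so its value is at least `I`; each union therefore adds only the
  -- excess of the new set. The bound sums the geometric series of excesses.
  have hacc : ∀ k N, accumulate (fun n => B (k + n)) N ∈ F ∧
      Φ (accumulate (fun n => B (k + n)) N) ≤ I + (1 / 2) ^ k * (2 - (1 / 2) ^ N) := by
    intro k N
    induction N with
    | zero =>
      simp only [accumulate_zero_nat, add_zero, pow_zero]
      exact ⟨hBF k, by linarith [hB k]⟩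
    | succ N ih =>
      rw [accumulate_succ]
      refine ⟨hunion _ ih.1 _ (hBF _), ?_⟩
      have h1 := hΦ.submod _ _ (hmeas _ ih.1) (hmeas _ (hBF (k + (N + 1))))
      have h2 := hIle _ (hinter _ ih.1 _ (hBF (k + (N + 1))))
      have h3 := hB (k + (N + 1))
      have h4 := ih.2
      rw [pow_add, pow_succ _ N] at h3
      rw [pow_succ _ N]
      linarith
  have htail : ∀ k, Φ (⋃ n, B (k + n)) ≤ I + (1 / 2) ^ k * 2 := by
    intro k
    rw [← iUnion_accumulate]
    refine hΦ.iUnion_le (fun n => hmeas _ (hacc k n).1) monotone_accumulate fun N => ?_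
    refine (hacc k N).2.trans ?_
    have : (0 : ℝ) ≤ (1 / 2) ^ k * (1 / 2) ^ N := by positivity
    linarith
  have htailF : ∀ k, (⋃ n, B (k + n)) ∈ F := fun k => hU _ fun n => hBF _
  -- The minimizer is the limsup of the minimizing sequence.
  refine ⟨⋂ k, ⋃ n, B (k + n), hI _ htailF, fun A hA => le_trans ?_ (hIle A hA)⟩
  refine le_of_forall_pos_le_add fun δ hδ => ?_
  refine hΦ.iInter_le (fun k => hmeas _ (htailF k)) ?_ ?_
  · intro i j hij
    refine iUnion_subset fun n => ?_
    obtain ⟨d, rfl⟩ := Nat.exists_eq_add_of_le hij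
    rw [add_assoc]
    exact subset_iUnion (fun n => B (i + n)) (d + n)
  · have hlim : Tendsto (fun k : ℕ => (1 / 2 : ℝ) ^ k * 2) atTop (𝓝 (0 * 2)) :=
      (tendsto_pow_atTop_nhds_zero_of_lt_one (by norm_num) (by norm_num)).mul_const 2
    rw [zero_mul] at hlim
    filter_upwards [hlim.eventually_lt_const hδ] with k hk
    linarith [htail k]

end SubmodularLSC

/-! ### The lattice of minimizers -/

/-- The measurable minimizers of a set functional. -/
def minimizers (Φ : Set X → ℝ) : Set (Set X) :=
  {A | MeasurableSet A ∧ ∀ B, MeasurableSet B → Φ A ≤ Φ B}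

theorem compl_mem_minimizers {Φ : Set X → ℝ} {A : Set X} :
    Aᶜ ∈ minimizers (fun B => Φ Bᶜ) ↔ A ∈ minimizers Φ := by
  refine ⟨fun h => ⟨h.1.of_compl, fun B hB => ?_⟩, fun h => ⟨h.1.compl, fun B hB => ?_⟩⟩
  · simpa using h.2 Bᶜ hB.compl
  · simpa using h.2 Bᶜ hB.compl

namespace SubmodularLSC

variable {Φ : Set X → ℝ}

theorem union_mem_minimizers (hΦ : SubmodularLSC Φ) {A B : Set X} (hA : A ∈ minimizers Φ)
    (hB : B ∈ minimizers Φ) : A ∪ B ∈ minimizers Φ := by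
  refine ⟨hA.1.union hB.1, fun C hC => ?_⟩
  linarith [hΦ.submod A B hA.1 hB.1, hA.2 _ (hA.1.inter hB.1), hB.2 C hC]

theorem iUnion_mem_minimizers (hΦ : SubmodularLSC Φ) {B : ℕ → Set X}
    (hB : ∀ n, B n ∈ minimizers Φ) : (⋃ n, B n) ∈ minimizers Φ := by
  have hacc : ∀ n, accumulate B n ∈ minimizers Φ := by
    intro n
    induction n with
    | zero => simpa using hB 0
    | succ n ih =>
      rw [accumulate_succ]
      exact hΦ.union_mem_minimizers ih (hB _)
  refine ⟨MeasurableSet.iUnion fun n => (hB n).1, fun C hC => ?_⟩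
  rw [← iUnion_accumulate]
  exact hΦ.iUnion_le (fun n => (hacc n).1) monotone_accumulate fun n => (hacc n).2 C hC

theorem iInter_mem_minimizers (hΦ : SubmodularLSC Φ) {B : ℕ → Set X}
    (hB : ∀ n, B n ∈ minimizers Φ) : (⋂ n, B n) ∈ minimizers Φ := by
  rw [← compl_mem_minimizers, compl_iInter]
  exact hΦ.compl.iUnion_mem_minimizers fun n => compl_mem_minimizers.2 (hB n)

theorem nonempty_minimizers (hΦ : SubmodularLSC Φ) : (minimizers Φ).Nonempty := by
  obtain ⟨C, hC, h⟩ := hΦ.exists_min {A | MeasurableSet A} ⟨∅, MeasurableSet.empty⟩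
    (fun A hA => hA) (fun B hB => MeasurableSet.iUnion hB) (fun B hB => MeasurableSet.iInter hB)
  exact ⟨C, hC, h⟩

end SubmodularLSC

theorem submodularLSC_measureReal (m : Measure X) [IsFiniteMeasure m] :
    SubmodularLSC (fun A => m.real A) where
  nonneg A _ := measureReal_nonneg
  submod A B _ hB := (measureReal_union_add_inter hB).le
  iUnion B _ hm c hc :=
    ((ENNReal.tendsto_toReal (measure_ne_top _ _)).comp
      (tendsto_measure_iUnion_atTop hm)).eventually_const_lt hc
  iInter B hB hm c hc :=
    ((ENNReal.tendsto_toReal (measure_ne_top _ _)).comp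
      (tendsto_measure_iInter_atTop (fun n => (hB n).nullMeasurableSet) hm
        ⟨0, measure_ne_top _ _⟩)).eventually_const_lt hc

/-- There is a minimizer containing every other minimizer up to a null set. -/
theorem SubmodularLSC.exists_greatest_minimizer {Φ : Set X → ℝ} (hΦ : SubmodularLSC Φ)
    (ν : Measure X) [IsFiniteMeasure ν] :
    ∃ M ∈ minimizers Φ, ∀ A ∈ minimizers Φ, ν (A \ M) = 0 := by
  -- Minimizing `ν Mᶜ` maximizes `ν M`; since `M ∪ A` is again a minimizer, `A` cannot add mass to
  -- `M`.
  obtain ⟨M, hM, h⟩ := (submodularLSC_measureReal ν).compl.exists_min (minimizers Φ)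
    hΦ.nonempty_minimizers (fun A hA => hA.1) (fun B hB => hΦ.iUnion_mem_minimizers hB)
    (fun B hB => hΦ.iInter_mem_minimizers hB)
  refine ⟨M, hM, fun A hA => ?_⟩
  have h1 := h _ (hΦ.union_mem_minimizers hM hA)
  rw [compl_union] at h1
  have h2 := measureReal_inter_add_sdiff (μ := ν) (s := Mᶜ) hA.1
  rw [sdiff_eq Mᶜ A] at h2
  have h3 : ν.real (A \ M) = 0 := by
    rw [sdiff_eq, inter_comm]
    exact le_antisymm (by linarith) measureReal_nonneg
  rwa [measureReal_eq_zero_iff] at h3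

/-- There is a minimizer contained in every other minimizer up to a null set. -/
theorem SubmodularLSC.exists_least_minimizer {Φ : Set X → ℝ} (hΦ : SubmodularLSC Φ)
    (ν : Measure X) [IsFiniteMeasure ν] :
    ∃ M ∈ minimizers Φ, ∀ A ∈ minimizers Φ, ν (M \ A) = 0 := by
  obtain ⟨M, hM, h⟩ := hΦ.compl.exists_greatest_minimizer ν
  refine ⟨Mᶜ, by rwa [← compl_mem_minimizers, compl_compl], fun A hA => ?_⟩
  have := h _ (compl_mem_minimizers.2 hA)
  rwa [sdiff_eq, inter_comm, ← sdiff_eq] at this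

/-! ### Infima over `ν`-classes -/

theorem nuEquiv_iff {ν : Measure X} {A B : Set X} : NuEquiv ν A B ↔ A =ᵐ[ν] B :=
  measure_symmDiff_eq_zero_iff

theorem nuLE_iff {ν : Measure X} {A B : Set X} : NuLE ν A B ↔ ν (A \ B) = 0 := by
  rw [NuLE, ae_iff]
  congr! 2
  ext x
  by_cases hA : x ∈ A <;> by_cases hB : x ∈ B <;> simp [ind, hA, hB]

/-- The infimum of a set functional over the measurable sets in a `ν`-equivalence class. -/
noncomputable def classInf (ν : Measure X) (Φ : Set X → ℝ) (A : Set X) : ℝ :=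
  ⨅ B : {B : Set X // MeasurableSet B ∧ NuEquiv ν A B}, Φ (B : Set X)

theorem classInf_compl (ν : Measure X) (Φ : Set X → ℝ) (A : Set X) :
    classInf ν (fun B => Φ Bᶜ) Aᶜ = classInf ν Φ A := by
  have key : ∀ A B : Set X, MeasurableSet B ∧ NuEquiv ν A B →
      MeasurableSet Bᶜ ∧ NuEquiv ν Aᶜ Bᶜ := fun A B h =>
    ⟨h.1.compl, nuEquiv_iff.2 (nuEquiv_iff.1 h.2).compl⟩
  refine Equiv.iInf_congr ⟨fun B => ⟨(B : Set X)ᶜ, by simpa using key _ _ B.2⟩,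
    fun B => ⟨(B : Set X)ᶜ, key _ _ B.2⟩, fun B => by simp, fun B => by simp⟩ fun B => ?_
  simp

namespace SubmodularLSC

variable {Φ : Set X → ℝ} {ν : Measure X}

theorem classInf_le (hΦ : SubmodularLSC Φ) {A B : Set X} (hB : MeasurableSet B)
    (h : A =ᵐ[ν] B) : classInf ν Φ A ≤ Φ B :=
  ciInf_le (f := fun B : {B : Set X // MeasurableSet B ∧ NuEquiv ν A B} => Φ (B : Set X))
    ⟨0, by rintro _ ⟨C, rfl⟩; exact hΦ.nonneg _ C.2.1⟩ ⟨B, hB, nuEquiv_iff.2 h⟩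

theorem exists_eq_classInf (hΦ : SubmodularLSC Φ) (ν : Measure X) {A : Set X}
    (hA : MeasurableSet A) :
    ∃ B, MeasurableSet B ∧ A =ᵐ[ν] B ∧ Φ B = classInf ν Φ A := by
  obtain ⟨C, ⟨hC, hAC⟩, h⟩ := hΦ.exists_min {B | MeasurableSet B ∧ A =ᵐ[ν] B}
    ⟨A, hA, EventuallyEq.rfl⟩ (fun B hB => hB.1)
    (fun B hB => ⟨MeasurableSet.iUnion fun n => (hB n).1, by
      simpa [iUnion_const] using Filter.EventuallyEq.countable_iUnion (s := fun _ => A) fun n => (hB n).2⟩)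
    (fun B hB => ⟨MeasurableSet.iInter fun n => (hB n).1, by
      simpa [iInter_const] using Filter.EventuallyEq.countable_iInter (s := fun _ => A) fun n => (hB n).2⟩)
  refine ⟨C, hC, hAC, le_antisymm ?_ (hΦ.classInf_le hC hAC)⟩
  have : Nonempty {B : Set X // MeasurableSet B ∧ NuEquiv ν A B} :=
    ⟨⟨C, hC, nuEquiv_iff.2 hAC⟩⟩
  exact le_ciInf fun B => h _ ⟨B.2.1, nuEquiv_iff.1 B.2.2⟩

/-- Optimal representatives need not be monotone, but their accumulated unions are, and stay
optimal: `accumulate B n ∩ B (n + 1)` represents `A n`, so its value cancels that of `accumulate B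
n` in the submodular inequality. -/
theorem classInf_iUnion (hΦ : SubmodularLSC Φ) (ν : Measure X) {A : ℕ → Set X}
    (hA : ∀ n, MeasurableSet (A n)) (hm : Monotone A) {c : ℝ}
    (hc : c < classInf ν Φ (⋃ n, A n)) : ∀ᶠ n in atTop, c < classInf ν Φ (A n) := by
  choose B hB hAB hBΦ using fun n => hΦ.exists_eq_classInf ν (hA n)
  have hacc : ∀ n, MeasurableSet (accumulate B n) ∧ A n =ᵐ[ν] accumulate B n ∧
      Φ (accumulate B n) ≤ classInf ν Φ (A n) := by
    intro n
    induction n with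
    | zero =>
      rw [accumulate_zero_nat]
      exact ⟨hB 0, hAB 0, (hBΦ 0).le⟩
    | succ n ih =>
      obtain ⟨h1, h2, h3⟩ := ih
      rw [accumulate_succ]
      refine ⟨h1.union (hB _), ?_, ?_⟩
      · have := h2.union (hAB (n + 1))
        rwa [union_eq_self_of_subset_left (hm n.le_succ)] at this
      · have h4 : A n =ᵐ[ν] (accumulate B n ∩ B (n + 1) : Set X) := by
          have := h2.inter (hAB (n + 1))
          rwa [inter_eq_self_of_subset_left (hm n.le_succ)] at this
        linarith [hΦ.submod _ _ h1 (hB (n + 1)), hΦ.classInf_le (h1.inter (hB (n + 1))) h4,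
          hBΦ (n + 1)]
  have hU := hΦ.classInf_le (MeasurableSet.iUnion fun n => (hacc n).1)
    (Filter.EventuallyEq.countable_iUnion fun n => (hacc n).2.1)
  filter_upwards [hΦ.iUnion _ (fun n => (hacc n).1) monotone_accumulate c (hc.trans_le hU)]
    with n hn
  exact hn.trans_le (hacc n).2.2

theorem classInf (hΦ : SubmodularLSC Φ) (ν : Measure X) : SubmodularLSC (classInf ν Φ) where
  nonneg A hA := by
    obtain ⟨B, hB, -, h⟩ := hΦ.exists_eq_classInf ν hA
    exact h ▸ hΦ.nonneg B hB
  submod A A' hA hA' := by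
    obtain ⟨B, hB, hAB, h⟩ := hΦ.exists_eq_classInf ν hA
    obtain ⟨B', hB', hAB', h'⟩ := hΦ.exists_eq_classInf ν hA'
    linarith [hΦ.submod B B' hB hB', hΦ.classInf_le (hB.union hB') (hAB.union hAB'),
      hΦ.classInf_le (hB.inter hB') (hAB.inter hAB')]
  iUnion A hA hm c hc := hΦ.classInf_iUnion ν hA hm hc
  iInter A hA hm c hc := by
    simp_rw [← classInf_compl ν Φ] at hc ⊢
    rw [compl_iInter] at hc
    exact hΦ.compl.classInf_iUnion ν (fun n => (hA n).compl)
      (fun i j h => compl_subset_compl.2 (hm h)) hc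

end SubmodularLSC

/-! ### Risk and pre-perimeter as set functionals -/

theorem ind_compl {X : Type*} (A : Set X) (x : X) : ind Aᶜ x = 1 - ind A x := by
  by_cases hx : x ∈ A <;> simp [ind, hx]

theorem integrable_ind {m : Measure X} [IsFiniteMeasure m] {A : Set X} (hA : MeasurableSet A) :
    Integrable (ind A) m :=
  (integrable_const 1).indicator hA

theorem integral_ind {m : Measure X} {A : Set X} (hA : MeasurableSet A) :
    ∫ x, ind A x ∂m = m.real A :=
  integral_indicator_one hA

theorem integral_ind_sub_ind (m : Measure X) [IsFiniteMeasure m] {A B : Set X}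
    (hA : MeasurableSet A) (hB : MeasurableSet B) :
    ∫ x, (ind A x - ind B x) ∂m = m.real A - m.real B := by
  rw [integral_sub (integrable_ind hA) (integrable_ind hB), integral_ind hA, integral_ind hB]

/-- The unnormalized class measure `A ↦ μ (A × {i})`. -/
noncomputable def slice (μ : Measure (X × Fin 2)) (i : Fin 2) : Measure X :=
  (μ.restrict (univ ×ˢ {i})).map Prod.fst

instance (μ : Measure (X × Fin 2)) [IsFiniteMeasure μ] (i : Fin 2) :
    IsFiniteMeasure (slice μ i) := by
  unfold slice
  infer_instance

theorem slice_apply (μ : Measure (X × Fin 2)) (i : Fin 2) {A : Set X} (hA : MeasurableSet A) :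
    slice μ i A = μ (A ×ˢ {i}) := by
  rw [slice, Measure.map_apply measurable_fst hA, Measure.restrict_apply (measurable_fst hA)]
  congr 1
  ext p
  simp

/-- The normalization cancels; for a class of probability zero both sides vanish. -/
theorem classProb_mul_integral (μ : Measure (X × Fin 2)) [IsFiniteMeasure μ] (i : Fin 2)
    (f : X → ℝ) : classProb μ i * ∫ x, f x ∂(condDist μ i) = ∫ x, f x ∂(slice μ i) := by
  rw [classProb, condDist, integral_smul_measure, smul_eq_mul, ← mul_assoc, ENNReal.toReal_inv]
  by_cases h : μ (univ ×ˢ {i}) = 0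
  · have : slice μ i = 0 := by rw [slice, Measure.restrict_eq_zero.2 h, Measure.map_zero]
    simp [h, this]
  · rw [mul_inv_cancel₀ (ENNReal.toReal_ne_zero.2 ⟨h, measure_ne_top _ _⟩), one_mul, slice]

theorem risk_eq (μ : Measure (X × Fin 2)) [IsFiniteMeasure μ] {A : Set X} (hA : MeasurableSet A) :
    risk μ A = (slice μ 0).real A + (slice μ 1).real Aᶜ := by
  have h0 : MeasurableSet (A ×ˢ {0} : Set (X × Fin 2)) := hA.prod (measurableSet_singleton _)
  have h1 : MeasurableSet (Aᶜ ×ˢ {1} : Set (X × Fin 2)) := hA.compl.prod (measurableSet_singleton _)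
  have h : ∀ p : X × Fin 2, |ind A p.1 - ((p.2 : ℕ) : ℝ)| =
      ind (A ×ˢ {0}) p + ind (Aᶜ ×ˢ {1}) p := by
    rintro ⟨x, i⟩
    by_cases hx : x ∈ A <;> fin_cases i <;> simp [ind, hx, indicator]
  simp_rw [risk, h]
  rw [integral_add (integrable_ind h0) (integrable_ind h1), integral_ind h0, integral_ind h1]
  simp_rw [measureReal_def, slice_apply μ _ hA, slice_apply μ _ hA.compl]

theorem iSup_ind_ball {X : Type*} [MetricSpace X] {ε : ℝ} (hε : 0 < ε) (A : Set X) (x : X) :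
    (⨆ z : Metric.ball x ε, ind A (z : X)) = ind (Metric.thickening ε A) x := by
  have : Nonempty (Metric.ball x ε) := ⟨⟨x, Metric.mem_ball_self hε⟩⟩
  have hle : ∀ z, ind A z ≤ 1 := fun z => indicator_le_self' (fun _ _ => zero_le_one) z
  by_cases hx : x ∈ Metric.thickening ε A
  · obtain ⟨z, hz, hxz⟩ := Metric.mem_thickening_iff.1 hx
    rw [show ind (Metric.thickening ε A) x = 1 from indicator_of_mem hx _]
    refine le_antisymm (ciSup_le fun z => hle z) ?_
    have := le_ciSup (f := fun z : Metric.ball x ε => ind A (z : X))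
      ⟨1, by rintro _ ⟨z, rfl⟩; exact hle z⟩ ⟨z, by rwa [Metric.mem_ball, dist_comm]⟩
    simpa [ind, hz] using this
  · rw [show ind (Metric.thickening ε A) x = 0 from indicator_of_notMem hx _]
    have : ∀ z : Metric.ball x ε, ind A (z : X) = 0 := fun z =>
      indicator_of_notMem (fun hz => hx (Metric.mem_thickening_iff.2
        ⟨z, hz, by rw [dist_comm]; exact z.2⟩)) _
    simp [this]

/-- Passing to complements turns the second perimeter term into the first one evaluated at `Aᶜ`. -/
theorem iInf_ind_ball {X : Type*} [MetricSpace X] {ε : ℝ} (hε : 0 < ε) (A : Set X) (x : X) :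
    (⨅ z : Metric.ball x ε, ind A (z : X)) = 1 - ind (Metric.thickening ε Aᶜ) x := by
  have : Nonempty (Metric.ball x ε) := ⟨⟨x, Metric.mem_ball_self hε⟩⟩
  rw [← iSup_ind_ball hε]
  simp_rw [ind_compl]
  have hbdd : BddBelow (range fun z : Metric.ball x ε => ind A (z : X)) :=
    ⟨0, by rintro _ ⟨z, rfl⟩; exact indicator_nonneg (fun _ _ => zero_le_one) _⟩
  have hbdd' : BddAbove (range fun z : Metric.ball x ε => 1 - ind A (z : X)) :=
    ⟨1, by
      rintro _ ⟨z, rfl⟩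
      exact sub_le_self _ (indicator_nonneg (fun _ _ => zero_le_one) _)⟩
  refine le_antisymm ?_ (le_ciInf fun z => ?_)
  · rw [le_sub_comm]
    exact ciSup_le fun z => sub_le_sub_left (ciInf_le hbdd z) 1
  · rw [sub_le_comm]
    exact le_ciSup hbdd' z

section Metric

variable {X : Type*} [MetricSpace X] [MeasurableSpace X] [BorelSpace X]

/-- Thickening commutes with unions, which gives continuity along increasing sequences. For
intersections only an inclusion holds, but it points the way needed for submodularity and lower
semicontinuity. -/
theorem submodularLSC_thickening (m : Measure X) [IsFiniteMeasure m] {ε : ℝ} (hε : 0 < ε) :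
    SubmodularLSC (fun A => m.real (Metric.thickening ε A) - m.real A) where
  nonneg A _ := sub_nonneg.2 (measureReal_mono (Metric.self_subset_thickening hε A))
  submod A B _ hB := by
    have h1 := measureReal_union_add_inter (μ := m) (s := A) hB
    have h2 := measureReal_union_add_inter (μ := m) (s := Metric.thickening ε A)
      (Metric.isOpen_thickening (δ := ε) (E := B)).measurableSet
    rw [← Metric.thickening_union] at h2
    have h3 : m.real (Metric.thickening ε (A ∩ B)) ≤
        m.real (Metric.thickening ε A ∩ Metric.thickening ε B) :=
      measureReal_mono (subset_inter (Metric.thickening_subset_of_subset ε inter_subset_left)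
        (Metric.thickening_subset_of_subset ε inter_subset_right))
    linarith
  iUnion B _ hm c hc := by
    rw [Metric.thickening_iUnion] at hc
    have h1 := (ENNReal.tendsto_toReal (measure_ne_top m _)).comp
      (tendsto_measure_iUnion_atTop (μ := m) (s := fun n => Metric.thickening ε (B n))
        fun i j h => Metric.thickening_subset_of_subset ε (hm h))
    have h2 := (ENNReal.tendsto_toReal (measure_ne_top m _)).comp
      (tendsto_measure_iUnion_atTop (μ := m) hm)
    exact (h1.sub h2).eventually_const_lt hc
  iInter B hB hm c hc := by
    have h2 := (ENNReal.tendsto_toReal (measure_ne_top m _)).comp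
      (tendsto_measure_iInter_atTop (μ := m) (fun n => (hB n).nullMeasurableSet) hm
        ⟨0, measure_ne_top _ _⟩)
    filter_upwards [(h2.const_sub (m.real (Metric.thickening ε (⋂ n, B n)))).eventually_const_lt hc]
      with n hn
    refine hn.trans_le (sub_le_sub_right (measureReal_mono ?_) _)
    exact Metric.thickening_subset_of_subset ε (iInter_subset _ _)

theorem prePer_eq (μ : Measure (X × Fin 2)) [IsFiniteMeasure μ] {ε : ℝ} (hε : 0 < ε) {A : Set X}
    (hA : MeasurableSet A) :
    prePer ε μ A = ε⁻¹ *
      (((slice μ 0).real (Metric.thickening ε A) - (slice μ 0).real A) +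
        ((slice μ 1).real (Metric.thickening ε Aᶜ) - (slice μ 1).real Aᶜ)) := by
  have h1 : ∀ x, ind A x - ⨅ z : Metric.ball x ε, ind A (z : X) =
      ind (Metric.thickening ε Aᶜ) x - ind Aᶜ x := fun x => by
    rw [iInf_ind_ball hε, ind_compl]; ring
  simp_rw [prePer, h1, iSup_ind_ball hε]
  rw [← integral_ind_sub_ind _ Metric.isOpen_thickening.measurableSet hA,
    ← integral_ind_sub_ind _ Metric.isOpen_thickening.measurableSet hA.compl,
    ← classProb_mul_integral, ← classProb_mul_integral]
  ring

end Metric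

theorem SubmodularLSC.congr {Φ Ψ : Set X → ℝ} (hΦ : SubmodularLSC Φ)
    (h : ∀ A, MeasurableSet A → Ψ A = Φ A) : SubmodularLSC Ψ where
  nonneg A hA := h A hA ▸ hΦ.nonneg A hA
  submod A B hA hB := by
    rw [h _ (hA.union hB), h _ (hA.inter hB), h _ hA, h _ hB]
    exact hΦ.submod A B hA hB
  iUnion B hB hm c hc := by
    simp_rw [h _ (hB _)]
    exact hΦ.iUnion B hB hm c (h _ (MeasurableSet.iUnion hB) ▸ hc)
  iInter B hB hm c hc := by
    simp_rw [h _ (hB _)]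
    exact hΦ.iInter B hB hm c (h _ (MeasurableSet.iInter hB) ▸ hc)

theorem submodularLSC_risk (μ : Measure (X × Fin 2)) [IsFiniteMeasure μ] :
    SubmodularLSC (risk μ) :=
  ((submodularLSC_measureReal (slice μ 0)).add (submodularLSC_measureReal (slice μ 1)).compl).congr
    fun _ hA => risk_eq μ hA

theorem submodularLSC_prePer {X : Type*} [MetricSpace X] [MeasurableSpace X] [BorelSpace X]
    (μ : Measure (X × Fin 2)) [IsFiniteMeasure μ] {ε : ℝ} (hε : 0 < ε) :
    SubmodularLSC (prePer ε μ) :=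
  (((submodularLSC_thickening (slice μ 0) hε).add
    (submodularLSC_thickening (slice μ 1) hε).compl).const_mul (inv_pos.2 hε)).congr
    fun _ hA => prePer_eq μ hε hA

theorem submodularLSC_objective {X : Type*} [MetricSpace X] [MeasurableSpace X] [BorelSpace X]
    (ν : Measure X) (μ : Measure (X × Fin 2)) [IsFiniteMeasure μ] {ε : ℝ} (hε : 0 < ε) :
    SubmodularLSC (objective ν ε μ) :=
  -- `per` unfolds to `classInf` of `prePer`.
  (submodularLSC_risk μ).add (((submodularLSC_prePer μ hε).classInf ν).const_mul hε)

theorem NuEquiv.symm {ν : Measure X} {A B : Set X} (h : NuEquiv ν A B) : NuEquiv ν B A :=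
  nuEquiv_iff.2 (nuEquiv_iff.1 h).symm

theorem nuEquiv_of_diff {ν : Measure X} {A B : Set X} (h : ν (A \ B) = 0) (h' : ν (B \ A) = 0) :
    NuEquiv ν A B :=
  measure_union_null h h'

end AdvTraining

theorem mainTheorem7 {X : Type*} [MetricSpace X] [TopologicalSpace.SeparableSpace X]
    [MeasurableSpace X] [BorelSpace X]
    (μ : Measure (X × Fin 2)) [IsProbabilityMeasure μ]
    (ν : Measure X) [IsFiniteMeasure ν]
    (ε : ℝ) (hε : 0 < ε) :
    (∃ A : Set X, AdvTraining.IsMaximalSolution ν ε μ A ∧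
      ∀ A' : Set X, AdvTraining.IsMaximalSolution ν ε μ A' → AdvTraining.NuEquiv ν A A') ∧
    (∃ A : Set X, AdvTraining.IsMinimalSolution ν ε μ A ∧
      ∀ A' : Set X, AdvTraining.IsMinimalSolution ν ε μ A' → AdvTraining.NuEquiv ν A A') := by
  open AdvTraining in
  have hJ := submodularLSC_objective ν μ hε
  constructor
  · obtain ⟨M, hM, h⟩ := hJ.exists_greatest_minimizer ν
    exact ⟨M, ⟨hM, fun A hA hMA => nuEquiv_of_diff (nuLE_iff.1 hMA) (h A hA)⟩,
      fun A hA => (hA.2 M hM (nuLE_iff.2 (h A hA.1))).symm⟩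
  · obtain ⟨M, hM, h⟩ := hJ.exists_least_minimizer ν
    exact ⟨M, ⟨hM, fun A hA hAM => nuEquiv_of_diff (h A hA) (nuLE_iff.1 hAM)⟩,
      fun A hA => (hA.2 M hM (nuLE_iff.2 (h A hA.1))).symm⟩
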